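/- Let $R$ be a commutative Noetherian ring and let $M$ be an $R$-module that is both linearly compact and strongly representable. Here: * $M$ is *linearly compact* if it carries a Hausdorff topology that makes it a topological $R$-module ($R$ discrete) with a basis of neighbourhoods of $0$ consisting of submodules, such that every family of cosets of closed submodules with the finite intersection property has non-empty intersection. * A non-zero module $N$ is *secondary* if every $r\in R$ acts on $N$ either surjectively or nilpotently. A module is *representable* if it is a finite (possibly empty) sum of secondary submodules. $M$ is *strongly representable* if it is representable and $(0:_M I)=\{x\in M\mid Ix=0\}$ is representable for every finitely generated ideal $I$ of $R$. For a commutative ring $A$ and an $A$-module $N$ put $$\operatorname{Cos}_A N=\{\mathfrak q\in\operatorname{Spec}A\mid \operatorname{Hom}_A(A_{\mathfrak q},N)\neq 0\},\qquad \operatorname{Co-dim}_A N=\sup\{\dim A/\mathfrak q\mid \mathfrak q\in\operatorname{Cos}_A N\}.$$ For $\mathfrak p\in\operatorname{Spec}R$ regard $\operatorname{Hom}_R(R_{\mathfrak p},M)$ as an $R_{\mathfrak p}$-module through the argument and put $$\operatorname{Cograde}_{R_{\mathfrak p}}\operatorname{Hom}_R(R_{\mathfrak p},M)=\inf\{\,i\ge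 0\mid \operatorname{Tor}_i^{R_{\mathfrak p}}(R_{\mathfrak p}/\mathfrak pR_{\mathfrak p},\operatorname{Hom}_R(R_{\mathfrak p},M))\neq 0\,\},$$ with $\inf\emptyset=\infty$. Let $\mathfrak p\in\operatorname{Cos}_R M$ and suppose $\operatorname{Cograde}_{R_{\mathfrak p}}\operatorname{Hom}_R(R_{\mathfrak p},M)<\infty$. Then $$\operatorname{Cograde}_{R_{\mathfrak p}}\operatorname{Hom}_R(R_{\mathfrak p},M)\le \operatorname{Co-dim}_{R_{\mathfrak p}}\operatorname{Hom}_R(R_{\mathfrak p},M).$$ -/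

import Mathlib

universe u v

/-- A topological `R`-module `M` (topological additive group, Hausdorff, with a neighbourhood basis
of `0` made of submodules) is *linearly compact* if every family of cosets of closed submodules
with the finite intersection property has non-empty intersection. The ring `R` carries the discrete
topology, and scalar multiplications are then automatically continuous; this includes every
linearly compact module over a ring with any coarser ring topology. -/
structure IsLinearlyCompact (R : Type u) (M : Type v) [CommRing R] [AddCommGroup M] [Module R M]
    [TopologicalSpace M] : Prop where
  isTopologicalAddGroup : IsTopologicalAddGroup M
  t2Space : T2Space M
  isLinearTopology : IsLinearTopology R M
  sInter_nonempty : ∀ F : Set (Set M),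
    (∀ C ∈ F, ∃ (x : M) (N : Submodule R M),
      IsClosed (N : Set M) ∧ C = {y : M | y - x ∈ N}) →
    (∀ G : Set (Set M), G ⊆ F → G.Finite → (⋂₀ G).Nonempty) →
    (⋂₀ F).Nonempty

/-- A non-zero module is *secondary* if every ring element acts on it either surjectively or
nilpotently. -/
structure IsSecondaryModule (R : Type u) (M : Type v) [CommRing R] [AddCommGroup M] [Module R M] :
    Prop where
  nontrivial : Nontrivial M
  surjective_or_nilpotent : ∀ r : R,
    Function.Surjective (fun x : M => r • x) ∨ ∃ n : ℕ, ∀ x : M, r ^ n • x = 0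

/-- A module is *representable* if it is a finite (possibly empty) sum of secondary submodules. -/
def IsRepresentable (R : Type u) (M : Type v) [CommRing R] [AddCommGroup M] [Module R M] : Prop :=
  ∃ (n : ℕ) (N : Fin n → Submodule R M), (∀ i, IsSecondaryModule R (N i)) ∧ (⨆ i, N i) = ⊤

/-- A representable module `M` is *strongly representable* if `(0 :_M I)` is representable for
every finitely generated ideal `I`. -/
structure IsStronglyRepresentable (R : Type u) (M : Type v) [CommRing R] [AddCommGroup M]
    [Module R M] : Prop where
  isRepresentable : IsRepresentable R M
  isRepresentable_torsionBySet : ∀ I : Ideal R, I.FG →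
    IsRepresentable R (Submodule.torsionBySet R M (I : Set R))

/-- The co-support of `M`: the primes `p` with `Hom_R(R_p, M) ≠ 0`. -/
def cosupport (R : Type u) (M : Type v) [CommRing R] [AddCommGroup M] [Module R M] :
    Set (PrimeSpectrum R) :=
  {p | Nontrivial (Localization.AtPrime p.asIdeal →ₗ[R] M)}

/-- The co-dimension of `M`: the supremum of `dim R/p` over the co-support, with value `⊥` when
the co-support is empty. -/
noncomputable def coDim (R : Type u) (M : Type v) [CommRing R] [AddCommGroup M] [Module R M] :
    WithBot ℕ∞ :=
  ⨆ p ∈ cosupport R M, ringKrullDim (R ⧸ p.asIdeal)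

/-- The co-localization `Hom_R(R_p, M)`, as an `R_p`-module via `(a • f) b = f (b * a)`. -/
noncomputable abbrev colocalization {R : Type u} [CommRing R] (p : PrimeSpectrum R) (M : Type u)
    [AddCommGroup M] [Module R M] : ModuleCat.{u} (Localization.AtPrime p.asIdeal) :=
  (ModuleCat.coextendScalars (algebraMap R (Localization.AtPrime p.asIdeal))).obj
    (ModuleCat.of R M)

/-- `inf {i | Tor_i^A(A/I, N) ≠ 0}`, with value `⊤` when there is no such `i`. -/
noncomputable def cograde {A : Type u} [CommRing A] (I : Ideal A) (N : ModuleCat.{u} A) : ℕ∞ :=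
  ⨅ (i : ℕ) (_ : Nontrivial (((CategoryTheory.Tor' (ModuleCat.{u} A) i).obj
    (ModuleCat.of A (A ⧸ I))).obj N)), (i : ℕ∞)

/-- The cograde of `Hom_R(R_p, M)` over `R_p`, taken with respect to the ideal `p R_p`. -/
noncomputable def colocalizationCograde {R : Type u} [CommRing R] (p : PrimeSpectrum R)
    (M : Type u) [AddCommGroup M] [Module R M] : ℕ∞ :=
  cograde (p.asIdeal.map (algebraMap R (Localization.AtPrime p.asIdeal))) (colocalization p M)

/-! Let `X = (0 :_M J)`, `H = Hom_R(R_p, X)` and `k = R_p/pR_p`. By induction on `n`, if `n` is the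
least degree with `Tor_n(k, H) ≠ 0`, then some `q` in the co-support of `H` has `dim R_p/q ≥ n`
(`exists_mem_cosupport_of_tor`). The theorem is the case `J = 0`.

Strong representability makes `X` a finite sum of secondary submodules `N_i` with primes `P_i`, and
linear compactness allows the `N_i` to be taken closed. If `n = 0`, then `H ≠ 0`, so some `P_i ⊆ p`,
and `P_i R_p` lies in the co-support of `H`.

If `n > 0`, then `Tor_0 = 0` says `pH = H`. A power of `p` kills the components with `P_i = p`, so
the maps in `H` take values in the sum of those with `P_i ⊊ p`. Prime avoidance gives `r ∈ p`
outside these `P_i`. It acts surjectively on that sum and hence, by linear compactness, on `H`. The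
kernel is `Hom_R(R_p, (0 :_X r))`; since `r` kills `k`, its first non-zero `Tor` sits one degree
lower. The prime `q` found for the kernel contains `r` and some such `P_i`, while `r ∉ P_i`. Passing
from `q` to `P_i R_p` therefore gains one dimension.

Both uses of linear compactness on maps rest on `IsLinearlyCompact.exists_compatible`: inverse
systems of closed cosets have points, so a map out of a localization can be built from constraints
on its values at the fractions `1/s`. -/

open CategoryTheory MonoidalCategory

/-! ### Dimension shifting for `Tor` -/

section Tor

variable {A : Type u} [CommRing A]

/-- The complex `P ⊗ N`, functorially in `N`. -/
noncomputable def tensorComplex (P : ChainComplex (ModuleCat.{u} A) ℕ) (N : ModuleCat.{u} A) :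
    ChainComplex (ModuleCat.{u} A) ℕ :=
  (((tensoringRight (ModuleCat.{u} A)).obj N).mapHomologicalComplex _).obj P

noncomputable def tensorComplexMap (P : ChainComplex (ModuleCat.{u} A) ℕ) {N N' : ModuleCat.{u} A}
    (f : N ⟶ N') : tensorComplex P N ⟶ tensorComplex P N' :=
  (NatTrans.mapHomologicalComplex ((tensoringRight (ModuleCat.{u} A)).map f) _).app P

/-- Projective modules are flat, so exactness holds in each degree. -/
lemma tensorComplex_shortExact (P : ChainComplex (ModuleCat.{u} A) ℕ)
    [∀ i, Projective (P.X i)] (S : ShortComplex (ModuleCat.{u} A)) (hS : S.ShortExact) :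
    ∃ w, (ShortComplex.mk (tensorComplexMap P S.f) (tensorComplexMap P S.g) w).ShortExact := by
  refine ⟨?_, ?_⟩
  · ext i : 1
    change P.X i ◁ S.f ≫ P.X i ◁ S.g = 0
    rw [← MonoidalCategory.whiskerLeft_comp, S.zero, MonoidalPreadditive.whiskerLeft_zero]
  · apply HomologicalComplex.shortExact_of_degreewise_shortExact
    intro i
    have hP : Projective (P.X i) := inferInstance
    have : Module.Projective A (P.X i) := (IsProjective.iff_projective (P.X i)).2 hP
    have hf := (ModuleCat.mono_iff_injective _).1 hS.mono_f
    have hg := (ModuleCat.epi_iff_surjective _).1 hS.epi_g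
    have h1 := Module.Flat.lTensor_shortComplex_exact (P.X i) S hS.exact
    have h2 : Mono (P.X i ◁ S.f) := (ModuleCat.mono_iff_injective _).2
      (Module.Flat.lTensor_preserves_injective_linearMap S.f.hom hf)
    have h3 : Epi (P.X i ◁ S.g) := (ModuleCat.epi_iff_surjective _).2
      (LinearMap.lTensor_surjective (P.X i) hg)
    exact { exact := h1, mono_f := h2, epi_g := h3 }

/-- On `P ⊗ N`, multiplication by `x` on `N` agrees with multiplication by `x` on `P`. The latter
lifts `x • 𝟙 k = 0`, as does the zero map, and two lifts of one map agree on homology. -/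
lemma tensorComplexMap_smul_homology {k N : ModuleCat.{u} A} (P : ProjectiveResolution k) (x : A)
    (hx : x • 𝟙 k = 0) (n : ℕ) :
    HomologicalComplex.homologyMap (tensorComplexMap P.complex (x • 𝟙 N)) n = 0 := by
  let F := (tensoringRight (ModuleCat.{u} A)).obj N
  have hcomm : (x • 𝟙 P.complex).f 0 ≫ P.π.f 0 = P.π.f 0 ≫ (0 : k ⟶ k) := by
    have : (x • 𝟙 P.complex).f 0 ≫ P.π.f 0 = P.π.f 0 ≫ (x • 𝟙 k) := by
      rw [HomologicalComplex.smul_f_apply, Linear.smul_comp, HomologicalComplex.id_f,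
        Category.id_comp]
      exact ((Linear.comp_smul _ k k (P.π.f 0) x (𝟙 k)).trans
        (congrArg (x • ·) (Category.comp_id (Y := k) (P.π.f 0)))).symm
    rw [this, hx]
  have h := P.isoLeftDerivedObj_hom_naturality (0 : k ⟶ k) P (x • 𝟙 P.complex) hcomm F n
  have h0 := P.isoLeftDerivedObj_hom_naturality (0 : k ⟶ k) P (0 : P.complex ⟶ P.complex)
    (by rw [HomologicalComplex.zero_f, Limits.zero_comp]; exact (Limits.comp_zero (Z := k)).symm) F n
  have h' := (cancel_epi (P.isoLeftDerivedObj F n).hom).1 (h.symm.trans h0)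
  rw [Functor.map_zero] at h'
  refine Eq.trans ?_ h'
  change HomologicalComplex.homologyMap _ n = HomologicalComplex.homologyMap _ n
  congr 1
  ext i : 1
  change P.complex.X i ◁ (x • 𝟙 N) = ((x • 𝟙 P.complex).f i) ▷ N
  rw [HomologicalComplex.smul_f_apply, HomologicalComplex.id_f,
    MonoidalLinear.whiskerLeft_smul, MonoidalLinear.smul_whiskerRight,
    MonoidalCategory.whiskerLeft_id, MonoidalCategory.id_whiskerRight]

lemma nontrivial_tor'_iff {k : ModuleCat.{u} A} (P : ProjectiveResolution k) (N : ModuleCat.{u} A)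
    (n : ℕ) : Nontrivial (((Tor' (ModuleCat.{u} A) n).obj k).obj N) ↔
      ¬ Limits.IsZero ((tensorComplex P.complex N).homology n) := by
  rw [← not_subsingleton_iff_nontrivial, ← ModuleCat.isZero_iff_subsingleton, not_iff_not]
  exact (P.isoLeftDerivedObj ((tensoringRight (ModuleCat.{u} A)).obj N) n).isZero_iff

/-- Dimension shifting for `Tor` along multiplication by an element that acts surjectively on `N`
and annihilates `k`. -/
lemma tor'_kernel_smul {k N N' : ModuleCat.{u} A} (x : A) (hx : x • 𝟙 k = 0) (i : N' ⟶ N)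
    (w : i ≫ (x • 𝟙 N) = 0) (hS : (ShortComplex.mk i (x • 𝟙 N) w).ShortExact) (n : ℕ) :
    (¬ Nontrivial (((Tor' (ModuleCat.{u} A) (n + 1)).obj k).obj N) →
      ¬ Nontrivial (((Tor' (ModuleCat.{u} A) n).obj k).obj N) →
      ¬ Nontrivial (((Tor' (ModuleCat.{u} A) n).obj k).obj N')) ∧
    (Nontrivial (((Tor' (ModuleCat.{u} A) (n + 1)).obj k).obj N) →
      Nontrivial (((Tor' (ModuleCat.{u} A) n).obj k).obj N')) := by
  let P := projectiveResolution k
  obtain ⟨w', h⟩ := tensorComplex_shortExact P.complex _ hS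
  simp only [nontrivial_tor'_iff P, not_not]
  refine ⟨fun h1 h2 ↦ ?_, fun h1 h2 ↦ h1 ?_⟩
  · exact (h.homology_exact₁ (n + 1) n (by simp)).isZero_of_both_zeros
      (h1.eq_of_src _ _) (h2.eq_of_tgt _ _)
  · exact (h.homology_exact₃ (n + 1) n (by simp)).isZero_of_both_zeros
      (tensorComplexMap_smul_homology P x hx (n + 1)) (h2.eq_of_tgt _ _)

lemma nontrivial_tor'_zero {I : Ideal A} {N : ModuleCat.{u} A} :
    Nontrivial (((Tor' (ModuleCat.{u} A) 0).obj (ModuleCat.of A (A ⧸ I))).obj N) ↔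
      I • (⊤ : Submodule A N) ≠ ⊤ := by
  have e := ((tensoringRight (ModuleCat.{u} A)).obj N).leftDerivedZeroIsoSelf.app
    (ModuleCat.of A (A ⧸ I))
  have e' : ((Tor' (ModuleCat.{u} A) 0).obj (ModuleCat.of A (A ⧸ I))).obj N ≃ₗ[A]
    TensorProduct A (A ⧸ I) N := e.toLinearEquiv
  rw [(e'.trans (TensorProduct.quotTensorEquivQuotSMul N I)).toEquiv.nontrivial_congr,
    Submodule.Quotient.nontrivial_iff]

end Tor

/-! ### Closed cosets and inverse limits in linearly compact modules -/

section LinearCompactness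

variable {R : Type u} [CommRing R] {M : Type v} [AddCommGroup M] [Module R M] [TopologicalSpace M]

/-- Cosets of closed submodules. -/
def IsClosedCoset (R : Type u) {M : Type v} [CommRing R] [AddCommGroup M] [Module R M]
    [TopologicalSpace M] (C : Set M) : Prop :=
  ∃ (x : M) (N : Submodule R M), IsClosed (N : Set M) ∧ C = {y : M | y - x ∈ N}

lemma IsClosedCoset.nonempty {C : Set M} (h : IsClosedCoset R C) : C.Nonempty := by
  obtain ⟨x, N, -, rfl⟩ := h
  exact ⟨x, by simp⟩

lemma IsClosedCoset.exists_eq {C : Set M} (h : IsClosedCoset R C) :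
    ∃ N : Submodule R M, IsClosed (N : Set M) ∧ ∀ x ∈ C, C = {y : M | y - x ∈ N} := by
  obtain ⟨x, N, hN, rfl⟩ := h
  refine ⟨N, hN, fun z hz ↦ Set.ext fun y ↦ ?_⟩
  have : y - x = (y - z) + (z - x) := by abel
  simp only [Set.mem_ofPred_eq] at hz ⊢
  rw [this, N.add_mem_iff_left hz]

lemma isClosedCoset_coe {N : Submodule R M} (hN : IsClosed (N : Set M)) :
    IsClosedCoset R (N : Set M) := ⟨0, N, hN, by simp⟩

lemma isClosedCoset_sInter {F : Set (Set M)} (hF : ∀ C ∈ F, IsClosedCoset R C)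
    (hne : (⋂₀ F).Nonempty) : IsClosedCoset R (⋂₀ F) := by
  obtain ⟨x, hx⟩ := hne
  choose! N hN hC using fun C hC ↦ (hF C hC).exists_eq
  refine ⟨x, ⨅ C ∈ F, N C, ?_, ?_⟩
  · simp only [Submodule.coe_iInf]
    exact isClosed_biInter hN
  · ext y
    simp only [Set.mem_sInter, Set.mem_ofPred_eq, Submodule.mem_iInf]
    refine forall₂_congr fun C h ↦ ?_
    conv_lhs => rw [hC C h x (hx C h)]
    rfl

lemma isClosedCoset_iInter {ι : Sort*} {C : ι → Set M} (hC : ∀ i, IsClosedCoset R (C i))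
    (hne : (⋂ i, C i).Nonempty) : IsClosedCoset R (⋂ i, C i) :=
  isClosedCoset_sInter (by rintro _ ⟨i, rfl⟩; exact hC i) hne

lemma IsClosedCoset.inter {C D : Set M} (hC : IsClosedCoset R C) (hD : IsClosedCoset R D)
    (hne : (C ∩ D).Nonempty) : IsClosedCoset R (C ∩ D) := by
  rw [Set.inter_eq_iInter] at hne ⊢
  exact isClosedCoset_iInter (by rintro (_ | _) <;> assumption) hne

namespace IsLinearlyCompact

variable (h : IsLinearlyCompact R M)
include h

lemma continuous_smul (r : R) : Continuous fun x : M ↦ r • x := by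
  have := h.isTopologicalAddGroup
  have := h.isLinearTopology
  refine continuous_of_continuousAt_zero (DistribSMul.toAddMonoidHom M r) ?_
  rw [ContinuousAt, map_zero, (IsLinearTopology.hasBasis_submodule R).tendsto_right_iff]
  intro N hN
  filter_upwards [hN] with x hx using N.smul_mem r hx

lemma isClosed_comap_smul {N : Submodule R M} (hN : IsClosed (N : Set M)) (r : R) :
    IsClosed (N.comap (LinearMap.lsmul R M r) : Set M) :=
  hN.preimage (h.continuous_smul r)

lemma isClosed_bot : IsClosed ((⊥ : Submodule R M) : Set M) := by
  have := h.t2Space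
  simp

/-- A downward directed family of closed cosets has non-empty intersection. -/
lemma iInter_nonempty {ι : Type*} [Nonempty ι] {C : ι → Set M} (hC : ∀ i, IsClosedCoset R (C i))
    (hd : Directed (· ⊇ ·) C) : (⋂ i, C i).Nonempty := by
  refine h.sInter_nonempty (Set.range C) (by rintro _ ⟨i, rfl⟩; exact hC i) fun G hG hfin ↦ ?_
  classical
  have hi (X : Set M) (hX : X ∈ G) : ∃ i, C i = X := hG hX
  choose! i hi using hi
  obtain ⟨z, hz⟩ := hd.finset_le (hfin.toFinset.image i)
  obtain ⟨x, hx⟩ := (hC z).nonempty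
  refine ⟨x, fun X hX ↦ ?_⟩
  rw [← hi X hX]
  exact hz (i X) (Finset.mem_image_of_mem i (hfin.mem_toFinset.2 hX)) hx

/-- The sum of a closed submodule and of the image of a closed submodule under a multiplication is
closed. -/
lemma isClosed_map_smul_sup {C D : Submodule R M} (hC : IsClosed (C : Set M))
    (hD : IsClosed (D : Set M)) (r : R) :
    IsClosed ((C.map (LinearMap.lsmul R M r) ⊔ D : Submodule R M) : Set M) := by
  have := h.isTopologicalAddGroup
  have := h.isLinearTopology
  refine isClosed_of_closure_subset fun y hy ↦ ?_
  let ι := {U : Submodule R M // IsOpen (U : Set M)}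
  have : Nonempty ι := ⟨⊤, by simp⟩
  -- Approximate solutions `c ∈ C` of `y ∈ r • c + D`, modulo an open submodule `U`. A common point
  -- `c` has `y - r • c` in every `U + D`, hence in `D`, which is closed.
  let E : ι → Set M := fun U ↦ {c | c ∈ C ∧ r • c - y ∈ U.1 ⊔ D}
  have hE : (⋂ U, E U).Nonempty := by
    refine h.iInter_nonempty (fun U ↦ ?_) fun U V ↦ ⟨⟨U.1 ⊓ V.1, U.2.inter V.2⟩, ?_, ?_⟩
    · have hcl : IsClosed ((U.1 ⊔ D : Submodule R M) : Set M) :=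
        AddSubgroup.isClosed_of_isOpen (U.1 ⊔ D).toAddSubgroup
          (AddSubgroup.isOpen_mono (H₁ := U.1.toAddSubgroup) (by exact le_sup_left (a := U.1)) U.2)
      have : ∃ z ∈ C.map (LinearMap.lsmul R M r) ⊔ D, z - y ∈ U.1 := by
        have := mem_closure_iff_nhds.1 hy ((fun z ↦ z - y) ⁻¹' (U.1 : Set M))
          ((U.2.preimage (by fun_prop)).mem_nhds (by simp))
        obtain ⟨z, h1, h2⟩ := this
        exact ⟨z, h2, h1⟩
      obtain ⟨z, hz, hzy⟩ := this
      obtain ⟨_, ⟨c, hc, rfl⟩, d, hd, rfl⟩ := Submodule.mem_sup.1 hz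
      have key : r • c - y ∈ U.1 ⊔ D :=
        Submodule.mem_sup.2 ⟨_, hzy, -d, D.neg_mem hd, by simp; abel⟩
      refine ⟨c, C ⊓ (U.1 ⊔ D).comap (LinearMap.lsmul R M r),
        hC.inter (h.isClosed_comap_smul hcl r), Set.ext fun c' ↦ ?_⟩
      simp only [Set.mem_ofPred_eq, Submodule.mem_inf, Submodule.mem_comap, LinearMap.lsmul_apply, E]
      rw [C.sub_mem_iff_left hc, smul_sub]
      refine and_congr Iff.rfl ?_
      rw [← Submodule.sub_mem_iff_left _ key]
      simp
    · exact fun c hc ↦ ⟨hc.1, sup_le_sup_right inf_le_left D hc.2⟩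
    · exact fun c hc ↦ ⟨hc.1, sup_le_sup_right inf_le_right D hc.2⟩
  obtain ⟨c, hc⟩ := hE
  simp only [Set.mem_iInter] at hc
  have hcD : y - r • c ∈ D := by
    by_contra hn
    have hnb : {x | x + (y - r • c) ∉ D} ∈ nhds (0 : M) :=
      (hD.isOpen_compl.preimage (f := fun x ↦ x + (y - r • c)) (by fun_prop)).mem_nhds
        (by simpa using hn)
    obtain ⟨U, hU, hUD⟩ := (IsLinearTopology.hasBasis_open_submodule R).mem_iff.1 hnb
    obtain ⟨u, hu, d, hd, hud⟩ := Submodule.mem_sup.1 (hc ⟨U, hU⟩).2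
    refine hUD hu (show u + (y - r • c) ∈ D from ?_)
    have : u + (y - r • c) = - d := by
      rw [← neg_sub (r • c) y, ← hud]; abel
    rw [this]
    exact D.neg_mem hd
  exact Submodule.mem_sup.2 ⟨r • c, ⟨c, (hc (Classical.arbitrary ι)).1, rfl⟩, _, hcD, by simp⟩

lemma isClosed_map_smul {C : Submodule R M} (hC : IsClosed (C : Set M)) (r : R) :
    IsClosed (C.map (LinearMap.lsmul R M r) : Set M) := by
  simpa using h.isClosed_map_smul_sup hC h.isClosed_bot r

lemma isClosed_sup {C D : Submodule R M} (hC : IsClosed (C : Set M)) (hD : IsClosed (D : Set M)) :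
    IsClosed ((C ⊔ D : Submodule R M) : Set M) := by
  have : C.map (LinearMap.lsmul R M 1) = C := by ext; simp
  simpa [this] using h.isClosed_map_smul_sup hC hD 1

lemma isClosed_finset_sup {ι : Type*} (s : Finset ι) {C : ι → Submodule R M}
    (hC : ∀ i, IsClosed (C i : Set M)) : IsClosed ((s.sup C : Submodule R M) : Set M) :=
  Finset.sup_induction (p := fun N : Submodule R M ↦ IsClosed (N : Set M)) h.isClosed_bot
    (fun _ h1 _ h2 ↦ h.isClosed_sup h1 h2) fun i _ ↦ hC i

lemma isClosedCoset_smul {C : Set M} (hC : IsClosedCoset R C) (r : R) :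
    IsClosedCoset R ((fun x ↦ r • x) '' C) := by
  obtain ⟨x, N, hN, rfl⟩ := hC
  refine ⟨r • x, _, h.isClosed_map_smul hN r, Set.ext fun y ↦ ⟨?_, ?_⟩⟩
  · rintro ⟨z, hz, rfl⟩
    exact ⟨z - x, hz, by simp [smul_sub]⟩
  · rintro ⟨z, hz, hzy⟩
    refine ⟨z + x, by simpa using hz, ?_⟩
    simp only [LinearMap.lsmul_apply] at hzy
    simp [hzy]

lemma isClosedCoset_smul_eq {r : R} {x y : M} (hy : r • y = x) :
    IsClosedCoset R {z : M | r • z = x} := by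
  refine ⟨y, _, h.isClosed_comap_smul h.isClosed_bot r, Set.ext fun z ↦ ?_⟩
  simp [smul_sub, hy, sub_eq_zero]

/-- A compatible family of closed cosets indexed by a submonoid, the transition maps being the
multiplications, has a compatible family of elements. -/
theorem exists_compatible (S : Submonoid R) (C : S → Set M) (hC : ∀ s, IsClosedCoset R (C s))
    (hcomp : ∀ (t s : S), ∀ y ∈ C (t * s), (t : R) • y ∈ C s) :
    ∃ g : S → M, (∀ s, g s ∈ C s) ∧ ∀ t s : S, g s = (t : R) • g (t * s) := by
  let Fib (E : Set (S × M)) (s : S) : Set M := {y | (s, y) ∈ E}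
  let P : Set (Set (S × M)) := {E | (∀ s, IsClosedCoset R (Fib E s)) ∧
    ∀ (t s : S), ∀ y ∈ Fib E (t * s), (t : R) • y ∈ Fib E s}
  -- A subsystem is encoded as a subset of `S × M` with fibres the cosets; take a minimal one inside
  -- `C`.
  obtain ⟨E, hE0, hE⟩ := zorn_superset_nonempty P (by
    intro c hcP hch hne
    have : Nonempty c := hne.to_subtype
    refine ⟨⋂₀ c, ⟨fun s ↦ ?_, fun t s y hy X hX ↦ (hcP hX).2 t s y (hy X hX)⟩,
      fun s hs ↦ Set.sInter_subset_of_mem hs⟩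
    have : Fib (⋂₀ c) s = ⋂ X : c, Fib X.1 s := by
      ext y; simp [Fib]
    rw [this]
    refine isClosedCoset_iInter (fun X ↦ (hcP X.2).1 s)
      (h.iInter_nonempty (fun X ↦ (hcP X.2).1 s) fun X Y ↦ ?_)
    rcases hch.total X.2 Y.2 with hXY | hXY
    · exact ⟨X, subset_rfl, fun y hy ↦ hXY hy⟩
    · exact ⟨Y, fun y hy ↦ hXY hy, subset_rfl⟩) {a | a.2 ∈ C a.1} ⟨hC, hcomp⟩
  have hEP := hE.prop
  have hmin (C' : S → Set M) (h1 : ∀ s, IsClosedCoset R (C' s))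
      (h2 : ∀ (t s : S), ∀ y ∈ C' (t * s), (t : R) • y ∈ C' s) (h3 : ∀ s, C' s ⊆ Fib E s) (s : S) :
      Fib E s ⊆ C' s := fun y hy ↦
    hE.le_of_le (y := {a : S × M | a.2 ∈ C' a.1}) ⟨h1, h2⟩ (fun a ha ↦ h3 a.1 ha) hy
  -- The intersections of all images from deeper levels form a subsystem again, so minimality makes
  -- the transition maps surjective.
  have hsurj (t s : S) : Fib E s ⊆ (fun y ↦ (t : R) • y) '' Fib E (t * s) := by
    have := hmin (fun s ↦ ⋂ t : S, (fun y ↦ (t : R) • y) '' Fib E (t * s)) (fun s ↦ ?_) ?_ ?_ s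
    · exact this.trans (Set.iInter_subset _ t)
    · refine isClosedCoset_iInter (fun t ↦ h.isClosedCoset_smul (hEP.1 _) _)
        (h.iInter_nonempty (fun t ↦ h.isClosedCoset_smul (hEP.1 _) _) fun t t' ↦ ⟨t * t', ?_, ?_⟩)
      · rintro _ ⟨y, hy, rfl⟩
        refine ⟨(t' : R) • y, hEP.2 t' (t * s) y ?_, ?_⟩
        · rwa [← mul_assoc, mul_comm t']
        · simp [mul_smul]
      · rintro _ ⟨y, hy, rfl⟩
        refine ⟨(t : R) • y, hEP.2 t (t' * s) y ?_, ?_⟩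
        · rwa [← mul_assoc]
        · simp [mul_smul, smul_comm (t' : R)]
    · intro t s y hy
      simp only [Set.mem_iInter] at hy ⊢
      intro v
      obtain ⟨z, hz, rfl⟩ := hy v
      refine ⟨(t : R) • z, hEP.2 t (v * s) z ?_, smul_comm _ _ _⟩
      rwa [mul_left_comm]
    · intro s
      refine (Set.iInter_subset _ 1).trans ?_
      rintro _ ⟨y, hy, rfl⟩
      simpa using hy
  -- Fix `x` at level `s`. Keeping at level `t` only the elements `s • z` with `t • z = x` gives a
  -- subsystem whose level `s` is contained in `{x}`.
  have hsub (s : S) : (Fib E s).Subsingleton := by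
    intro x hx y hy
    have := hmin (fun t ↦ (fun z ↦ (s : R) • z) '' (Fib E (s * t) ∩ {z | (t : R) • z = x}))
      (fun t ↦ ?_) ?_ ?_ s hy
    · obtain ⟨z, ⟨-, hz⟩, rfl⟩ := this
      exact hz.symm
    · obtain ⟨z, hz, hzx⟩ := hsurj t s hx
      refine h.isClosedCoset_smul ((hEP.1 _).inter (h.isClosedCoset_smul_eq hzx) ⟨z, ?_, hzx⟩) _
      rwa [mul_comm]
    · rintro t t' _ ⟨z, ⟨hz, hzx⟩, rfl⟩
      refine ⟨(t : R) • z, ⟨hEP.2 t (s * t') z ?_, ?_⟩, smul_comm _ _ _⟩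
      · rwa [mul_left_comm]
      · simpa [smul_smul, mul_comm] using hzx
    · rintro t _ ⟨z, ⟨hz, -⟩, rfl⟩
      exact hEP.2 s t z hz
  choose g hg using fun s ↦ (hEP.1 s).nonempty
  exact ⟨g, fun s ↦ hE0 (hg s), fun t s ↦ hsub s (hg s) (hEP.2 t s _ (hg _))⟩

end IsLinearlyCompact

end LinearCompactness

/-- A compatible family `g` over `S` defines a linear map on the localization, `r / s ↦ r • g s`. -/
theorem IsLocalization.exists_linearMap_of_compatible {R : Type*} [CommRing R] {M : Type*}
    [AddCommGroup M] [Module R M] (S : Submonoid R) (B : Type*) [CommRing B]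
    [Algebra R B] [IsLocalization S B] (g : S → M) (hg : ∀ t s : S, g s = (t : R) • g (t * s)) :
    ∃ f : B →ₗ[R] M, ∀ r s, f (IsLocalization.mk' B r s) = r • g s := by
  have hwd (r r' : R) (s s' : S) (h : IsLocalization.mk' B r s = IsLocalization.mk' B r' s') :
      r • g s = r' • g s' := by
    obtain ⟨c, hc⟩ := IsLocalization.eq.1 h
    have h1 : g s = (c * s' : S) • g (c * s' * s) := hg (c * s') s
    have h2 : g s' = (c * s : S) • g (c * s' * s) := by
      rw [mul_right_comm]
      exact hg (c * s) s'
    rw [h1, h2, Submonoid.smul_def, Submonoid.smul_def, smul_smul, smul_smul]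
    congr 1
    push_cast
    linear_combination hc
  let φ (b : B) : M := (IsLocalization.sec S b).1 • g (IsLocalization.sec S b).2
  have hφ (r : R) (s : S) : φ (IsLocalization.mk' B r s) = r • g s :=
    hwd _ _ _ _ (IsLocalization.mk'_sec B _)
  refine ⟨{ toFun := φ, map_add' := fun a b ↦ ?_, map_smul' := fun r b ↦ ?_ }, hφ⟩
  · obtain ⟨r, s, rfl⟩ := IsLocalization.exists_mk'_eq S a
    obtain ⟨r', s', rfl⟩ := IsLocalization.exists_mk'_eq S b
    rw [← IsLocalization.mk'_add, hφ, hφ, hφ, hg s' s, hg s s', smul_smul, smul_smul, ← mul_comm s,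
      add_smul]
  · obtain ⟨r', s', rfl⟩ := IsLocalization.exists_mk'_eq S b
    rw [IsLocalization.smul_mk', hφ, hφ, RingHom.id_apply, smul_smul]

/-! ### Secondary submodules and their attached primes -/

section Secondary

variable {R : Type u} [CommRing R] {M : Type v} [AddCommGroup M] [Module R M]

/-- The submodule `N` is secondary with attached prime `P`. -/
structure IsSecondaryAt (P : Ideal R) (N : Submodule R M) : Prop where
  ne_bot : N ≠ ⊥
  exists_smul_eq : ∀ r ∉ P, ∀ y ∈ N, ∃ z ∈ N, r • z = y
  exists_pow_smul_eq_zero : ∀ r ∈ P, ∃ n : ℕ, ∀ y ∈ N, r ^ n • y = 0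

/-- The attached prime is the radical of the annihilator: its elements act nilpotently, hence not
surjectively on a non-zero module, while the others act surjectively and so are closed under
products. -/
lemma IsSecondaryModule.exists_isSecondaryAt {N : Submodule R M} (h : IsSecondaryModule R N) :
    ∃ P : Ideal R, P.IsPrime ∧ IsSecondaryAt P N := by
  have := h.nontrivial
  have hP (r : R) : r ∈ (Module.annihilator R N).radical ↔ ∃ n : ℕ, ∀ x : N, r ^ n • x = 0 := by
    simp [Ideal.mem_radical_iff, Module.mem_annihilator]
  have hsurj (r : R) (hr : r ∉ (Module.annihilator R N).radical) :
      Function.Surjective (fun x : N ↦ r • x) :=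
    (h.surjective_or_nilpotent r).resolve_right fun hn ↦ hr ((hP r).2 hn)
  have hnot (r : R) (hr : r ∈ (Module.annihilator R N).radical) :
      ¬ Function.Surjective (fun x : N ↦ r • x) := fun hs ↦ by
    obtain ⟨n, hn⟩ := (hP r).1 hr
    have := hs.iterate n
    rw [smul_iterate] at this
    obtain ⟨y, hy⟩ := exists_ne (0 : N)
    obtain ⟨x, hx⟩ := this y
    exact hy (hx ▸ hn x)
  refine ⟨(Module.annihilator R N).radical, Ideal.isPrime_iff.2 ⟨?_, fun {a b} hab ↦ ?_⟩, ?_⟩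
  · rw [Ne, Ideal.eq_top_iff_one]
    exact fun h1 ↦ hnot 1 h1 fun x ↦ ⟨x, one_smul _ x⟩
  · by_contra! hn
    refine hnot _ hab ?_
    have := (hsurj a hn.1).comp (hsurj b hn.2)
    simpa [Function.comp_def, smul_smul] using this
  · refine ⟨(Submodule.nontrivial_iff_ne_bot).1 h.nontrivial, fun r hr y hy ↦ ?_, fun r hr ↦ ?_⟩
    · obtain ⟨z, hz⟩ := hsurj r hr ⟨y, hy⟩
      exact ⟨z, z.2, congrArg Subtype.val hz⟩
    · obtain ⟨n, hn⟩ := (hP r).1 hr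
      exact ⟨n, fun y hy ↦ congrArg Subtype.val (hn ⟨y, hy⟩)⟩

lemma IsSecondaryAt.map {P : Ideal R} {N : Submodule R M} (h : IsSecondaryAt P N)
    {M' : Type*} [AddCommGroup M'] [Module R M'] (f : M →ₗ[R] M') (hf : Function.Injective f) :
    IsSecondaryAt P (N.map f) where
  ne_bot hb := h.ne_bot (Submodule.map_injective_of_injective hf (by rw [hb, Submodule.map_bot]))
  exists_smul_eq := by
    rintro r hr _ ⟨y, hy, rfl⟩
    obtain ⟨z, hz, rfl⟩ := h.exists_smul_eq r hr y hy
    exact ⟨f z, ⟨z, hz, rfl⟩, by simp⟩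
  exists_pow_smul_eq_zero := by
    intro r hr
    obtain ⟨n, hn⟩ := h.exists_pow_smul_eq_zero r hr
    refine ⟨n, ?_⟩
    rintro _ ⟨y, hy, rfl⟩
    rw [← map_smul, hn y hy, map_zero]

/-- The closure works. Its image under `r ∉ P` is closed by linear compactness and contains `N`,
hence contains the closure; the kernel of `r ^ n` is closed, so nilpotency also passes to the
closure. -/
lemma IsSecondaryAt.exists_closed [TopologicalSpace M] (hlc : IsLinearlyCompact R M)
    {P : Ideal R} {N : Submodule R M} (h : IsSecondaryAt P N) :
    ∃ N' : Submodule R M, N ≤ N' ∧ IsClosed (N' : Set M) ∧ IsSecondaryAt P N' ∧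
      ∀ T : Submodule R M, IsClosed (T : Set M) → N ≤ T → N' ≤ T := by
  have := hlc.isTopologicalAddGroup
  have : ContinuousConstSMul R M := ⟨hlc.continuous_smul⟩
  have hmin (T : Submodule R M) (hT : IsClosed (T : Set M)) (hNT : N ≤ T) :
      N.topologicalClosure ≤ T := N.topologicalClosure_minimal hNT hT
  refine ⟨N.topologicalClosure, N.le_topologicalClosure, N.isClosed_topologicalClosure,
    ⟨?_, fun r hr ↦ ?_, fun r hr ↦ ?_⟩, hmin⟩
  · exact fun hb ↦ h.ne_bot (le_bot_iff.1 (hb ▸ N.le_topologicalClosure))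
  · intro y hy
    have := hmin _ (hlc.isClosed_map_smul N.isClosed_topologicalClosure r) (fun y hy ↦ ?_) hy
    · obtain ⟨z, hz, hzy⟩ := this
      exact ⟨z, hz, hzy⟩
    · obtain ⟨z, hz, hzy⟩ := h.exists_smul_eq r hr y hy
      exact ⟨z, N.le_topologicalClosure hz, hzy⟩
  · obtain ⟨n, hn⟩ := h.exists_pow_smul_eq_zero r hr
    refine ⟨n, fun y hy ↦ ?_⟩
    have := hmin _ (hlc.isClosed_comap_smul hlc.isClosed_bot (r ^ n))
      (fun y hy ↦ by simpa using hn y hy) hy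
    simpa using this

/-- A closed representable submodule of a linearly compact module is a finite sum of closed
secondary submodules. -/
lemma IsRepresentable.exists_closed [TopologicalSpace M] (hlc : IsLinearlyCompact R M)
    {T : Submodule R M} (hT : IsClosed (T : Set M)) (h : IsRepresentable R T) :
    ∃ (n : ℕ) (N : Fin n → Submodule R M) (P : Fin n → Ideal R), (∀ i, (P i).IsPrime) ∧
      (∀ i, IsClosed (N i : Set M)) ∧ (∀ i, IsSecondaryAt (P i) (N i)) ∧ ⨆ i, N i = T := by
  obtain ⟨n, N, hN, hsup⟩ := h
  choose P hP hNP using fun i ↦ (hN i).exists_isSecondaryAt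
  choose N' hle hcl hsec hmin using fun i ↦
    ((hNP i).map T.subtype T.injective_subtype).exists_closed hlc
  refine ⟨n, N', P, hP, hcl, hsec, le_antisymm (iSup_le fun i ↦ hmin i T hT ?_) ?_⟩
  · exact Submodule.map_subtype_le T (N i)
  · calc T = (⨆ i, N i).map T.subtype := by rw [hsup, Submodule.map_subtype_top]
      _ = ⨆ i, (N i).map T.subtype := Submodule.map_iSup _ _
      _ ≤ _ := iSup_mono hle

variable {n : ℕ} {N : Fin n → Submodule R M} {P : Fin n → Ideal R}

/-- For each `i`, a power of an element of `P i` outside `q` kills `N i`; their product stays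
outside the prime `q`. -/
lemma exists_notMem_forall_smul_eq_zero (hN : ∀ i, IsSecondaryAt (P i) (N i)) {q : Ideal R}
    (hq : q.IsPrime) (s : Finset (Fin n)) (hs : ∀ i ∈ s, ¬ P i ≤ q) :
    ∃ r ∉ q, ∀ i ∈ s, ∀ y ∈ N i, r • y = 0 := by
  have (i : Fin n) (hi : i ∈ s) : ∃ r ∉ q, ∀ y ∈ N i, r • y = 0 := by
    obtain ⟨r, hr, hrq⟩ := SetLike.not_le_iff_exists.1 (hs i hi)
    obtain ⟨k, hk⟩ := (hN i).exists_pow_smul_eq_zero r hr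
    exact ⟨r ^ k, fun h ↦ hrq (hq.mem_of_pow_mem k h), hk⟩
  choose! r hr hrN using this
  refine ⟨∏ i ∈ s, r i, fun h ↦ ?_, fun i hi y hy ↦ ?_⟩
  · obtain ⟨i, hi, hir⟩ := hq.prod_mem_iff.1 h
    exact hr i hi hir
  · obtain ⟨c, hc⟩ := Finset.dvd_prod_of_mem r hi
    rw [hc, mul_comm, mul_smul, hrN i hi y hy, smul_zero]

lemma smul_mem_finset_sup {s : Finset (Fin n)} {r : R}
    (hr : ∀ i ∉ s, ∀ y ∈ N i, r • y = 0) {y : M} (hy : y ∈ ⨆ i, N i) : r • y ∈ s.sup N := by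
  have : ⨆ i, N i ≤ (s.sup N).comap (LinearMap.lsmul R M r) := iSup_le fun i z hz ↦ by
    by_cases hi : i ∈ s
    · exact (s.sup N).smul_mem r (Finset.le_sup (f := N) hi hz)
    · simp [hr i hi z hz]
  exact this hy

lemma exists_smul_eq_of_mem_finset_sup (hN : ∀ i, IsSecondaryAt (P i) (N i))
    {s : Finset (Fin n)} {r : R} (hr : ∀ i ∈ s, r ∉ P i) {y : M} (hy : y ∈ s.sup N) :
    ∃ z ∈ s.sup N, r • z = y := by
  have : s.sup N ≤ (s.sup N).map (LinearMap.lsmul R M r) := Finset.sup_le fun i hi z hz ↦ by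
    obtain ⟨w, hw, hwz⟩ := (hN i).exists_smul_eq r (hr i hi) z hz
    exact ⟨w, Finset.le_sup (f := N) hi hw, hwz⟩
  exact this hy

lemma exists_pow_forall_smul_eq_zero (hN : ∀ i, IsSecondaryAt (P i) (N i)) {p : Ideal R}
    (hp : p.FG) (s : Finset (Fin n)) (hs : ∀ i ∈ s, p ≤ P i) :
    ∃ k : ℕ, ∀ r ∈ p ^ k, ∀ i ∈ s, ∀ y ∈ N i, r • y = 0 := by
  have (i : Fin n) (hi : i ∈ s) : ∃ k : ℕ, p ^ k ≤ Module.annihilator R (N i) := by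
    refine Ideal.exists_pow_le_of_le_radical_of_fg (fun r hr ↦ ?_) hp
    obtain ⟨k, hk⟩ := (hN i).exists_pow_smul_eq_zero r (hs i hi hr)
    exact ⟨k, Module.mem_annihilator.2 fun y ↦ Subtype.ext (hk y y.2)⟩
  choose! k hk using this
  refine ⟨s.sup k, fun r hr i hi y hy ↦ ?_⟩
  have := Module.mem_annihilator.1 (hk i hi (Ideal.pow_le_pow_right (Finset.le_sup hi) hr)) ⟨y, hy⟩
  exact congrArg Subtype.val this

end Secondary

/-! ### Co-localizations and their co-support -/

section CoLocalization

/-- As `a` is a unit in `A_q`, every value of a map from `A_q` is `a` times another value. -/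
lemma not_mem_cosupport {A : Type u} [CommRing A] {V : Type v} [AddCommGroup V] [Module A V]
    {q : PrimeSpectrum A} {a : A} (ha : a ∉ q.asIdeal) (hV : ∀ v : V, a • v = 0) :
    q ∉ cosupport A V := by
  rintro ⟨h⟩
  obtain ⟨f, hf⟩ := @exists_ne _ ⟨h⟩ 0
  refine hf (LinearMap.ext fun b ↦ ?_)
  have hu : IsUnit (algebraMap A (Localization.AtPrime q.asIdeal) a) :=
    IsLocalization.map_units (M := q.asIdeal.primeCompl) _ ⟨a, ha⟩
  obtain ⟨c, hc⟩ := hu.exists_right_inv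
  have : b = a • (c * b) := by rw [Algebra.smul_def, ← mul_assoc, hc, one_mul]
  rw [this, map_smul, hV, LinearMap.zero_apply]

variable {R : Type u} [CommRing R] (p : PrimeSpectrum R) (X : Type u) [AddCommGroup X] [Module R X]

local notation "Rp" => Localization.AtPrime (PrimeSpectrum.asIdeal p)

/-- Elements of the co-localization as linear maps on `R_p`. -/
noncomputable def colocalizationEquiv : colocalization p X ≃+ (Rp →ₗ[R] X) where
  toFun f :=
    { toFun := fun b ↦ ModuleCat.CoextendScalars.equiv _ _ f b
      map_add' := fun a b ↦ map_add (ModuleCat.CoextendScalars.equiv _ _ f) a b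
      map_smul' := fun r b ↦ by
        rw [Algebra.smul_def]
        exact LinearMap.map_smul (ModuleCat.CoextendScalars.equiv _ _ f) r b }
  invFun g := (ModuleCat.CoextendScalars.equiv _ _).symm
    { toFun := fun b ↦ g b
      map_add' := fun a b ↦ map_add g a b
      map_smul' := fun r b ↦ (congrArg g (Algebra.smul_def r (show Rp from b)).symm).trans
        (LinearMap.map_smul (M := Rp) g r b) }
  left_inv _ := rfl
  right_inv _ := rfl
  map_add' _ _ := rfl

variable {p X}

lemma colocalizationEquiv_smul (a : Rp) (f : colocalization p X) (b : Rp) :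
    colocalizationEquiv p X (a • f) b = colocalizationEquiv p X f (b * a) := rfl

lemma colocalizationEquiv_algebraMap_smul (r : R) (f : colocalization p X) (b : Rp) :
    colocalizationEquiv p X (algebraMap R Rp r • f) b = r • colocalizationEquiv p X f b := by
  rw [colocalizationEquiv_smul, mul_comm, ← Algebra.smul_def, map_smul]

lemma colocalization_ext {f g : colocalization p X}
    (h : ∀ b, colocalizationEquiv p X f b = colocalizationEquiv p X g b) : f = g :=
  (colocalizationEquiv p X).injective (LinearMap.ext h)

variable {M : Type v} [AddCommGroup M] [Module R M] {ι : X →ₗ[R] M}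

lemma exists_colocalization_lift (hι : Function.Injective ι) {B : Type*} [CommRing B] [Algebra R B]
    (g : B →ₗ[R] M) (hg : ∀ b, g b ∈ LinearMap.range ι) :
    ∃ g' : B →ₗ[R] X, ∀ b, ι (g' b) = g b := by
  refine ⟨(LinearEquiv.ofInjective ι hι).symm.toLinearMap ∘ₗ g.codRestrict _ hg, fun b ↦ ?_⟩
  have := LinearEquiv.apply_symm_apply (LinearEquiv.ofInjective ι hι) (g.codRestrict _ hg b)
  exact congrArg Subtype.val this

variable [TopologicalSpace M]

/-- A secondary closed submodule contributes its attached prime to the co-support of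
co-localizations. -/
lemma map_mem_cosupport_colocalization (hlc : IsLinearlyCompact R M) (hι : Function.Injective ι)
    {N : Submodule R M} (hN : IsClosed (N : Set M)) (hNι : N ≤ LinearMap.range ι) {P : Ideal R}
    (hP : P.IsPrime) (hNP : IsSecondaryAt P N) (hPp : P ≤ p.asIdeal) :
    ∃ q : PrimeSpectrum Rp, q.asIdeal = P.map (algebraMap R Rp) ∧
      q.asIdeal.comap (algebraMap R Rp) = P ∧ q ∈ cosupport Rp (colocalization p X) := by
  have hdisj : Disjoint (p.asIdeal.primeCompl : Set R) (P : Set R) :=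
    Set.disjoint_left.2 fun r hr hrP ↦ hr (hPp hrP)
  have hprime := IsLocalization.isPrime_of_isPrime_disjoint p.asIdeal.primeCompl Rp P hP hdisj
  have hcomap : (P.map (algebraMap R Rp)).comap (algebraMap R Rp) = P :=
    IsLocalization.under_map_of_isPrime_disjoint p.asIdeal.primeCompl Rp hP hdisj
  refine ⟨⟨P.map (algebraMap R Rp), hprime⟩, rfl, hcomap, ?_⟩
  let B := Localization.AtPrime (P.map (algebraMap R Rp))
  -- Localizing `R_p` at `P R_p` gives `R_P`.
  have hloc : IsLocalization.AtPrime B P := by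
    have := IsLocalization.isLocalization_isLocalization_atPrime_isLocalization
      p.asIdeal.primeCompl B (P.map (algebraMap R Rp))
    convert this
    exact hcomap.symm
  obtain ⟨y, hy, hy0⟩ := N.ne_bot_iff.1 hNP.ne_bot
  -- Dividing `y` compatibly by all `s ∉ P` inside `N` yields a map `R_P → N` with `1 ↦ y`.
  obtain ⟨g, hg, hgc⟩ := hlc.exists_compatible P.primeCompl (fun s ↦ N ∩ {z | (s : R) • z = y})
    (fun s ↦ by
      obtain ⟨z, hz, hzy⟩ := hNP.exists_smul_eq s s.2 y hy
      exact (isClosedCoset_coe hN).inter (hlc.isClosedCoset_smul_eq hzy) ⟨z, hz, hzy⟩)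
    (by
      rintro t s z ⟨hz, hzy⟩
      refine ⟨N.smul_mem _ hz, ?_⟩
      simpa [smul_smul, mul_comm] using hzy)
  obtain ⟨f, hf⟩ := IsLocalization.exists_linearMap_of_compatible P.primeCompl B g hgc
  obtain ⟨f', hf'⟩ := exists_colocalization_lift hι f fun b ↦ by
    obtain ⟨r, s, rfl⟩ := IsLocalization.exists_mk'_eq P.primeCompl b
    rw [hf]
    exact hNι (N.smul_mem _ (hg s).1)
  -- The adjoint of `f'`, sending `a` to `c ↦ f' (c • a)`.
  let H : B →ₗ[Rp] colocalization p X :=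
    { toFun := fun a ↦ (colocalizationEquiv p X).symm
        (f' ∘ₗ (LinearMap.toSpanSingleton Rp B a).restrictScalars R)
      map_add' := fun a b ↦ colocalization_ext fun c ↦ by
        simp
      map_smul' := fun a b ↦ colocalization_ext fun c ↦ by
        rw [RingHom.id_apply, colocalizationEquiv_smul]
        simp [mul_smul] }
  refine ⟨⟨H, 0, fun h0 ↦ hy0 ?_⟩⟩
  have h1 : f' 1 = 0 := by
    have : colocalizationEquiv p X (H 1) 1 = 0 := by rw [h0]; simp
    simpa [H] using this
  have h2 := hf' 1
  have h3 := hf 1 1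
  rw [IsLocalization.mk'_one, map_one, ← h2, h1, map_zero, one_smul] at h3
  have h4 : ((1 : P.primeCompl) : R) • g 1 = y := (hg 1).2
  rw [← h4, ← h3, smul_zero]

omit [TopologicalSpace M] in
/-- Homomorphisms from `R_p` only see the secondary components with attached prime inside `p`. -/
lemma colocalization_mem_finset_sup {n : ℕ} {N : Fin n → Submodule R M} {P : Fin n → Ideal R}
    (hN : ∀ i, IsSecondaryAt (P i) (N i)) (hι : ⨆ i, N i = LinearMap.range ι)
    {s : Finset (Fin n)} (hs : ∀ i ∉ s, ¬ P i ≤ p.asIdeal) (f : colocalization p X) (b : Rp) :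
    ι (colocalizationEquiv p X f b) ∈ s.sup N := by
  classical
  obtain ⟨r, hr, hrN⟩ := exists_notMem_forall_smul_eq_zero hN p.isPrime sᶜ
    (fun i hi ↦ hs i (Finset.mem_compl.1 hi))
  have hu : IsUnit (algebraMap R Rp r) :=
    IsLocalization.map_units (M := p.asIdeal.primeCompl) _ ⟨r, hr⟩
  obtain ⟨c, hc⟩ := hu.exists_right_inv
  have : b = r • (c * b) := by rw [Algebra.smul_def, ← mul_assoc, hc, one_mul]
  rw [this, map_smul, map_smul]
  exact smul_mem_finset_sup (fun i hi ↦ hrN i (Finset.mem_compl.2 hi))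
    (hι ▸ LinearMap.mem_range_self ι _)

omit [TopologicalSpace M] in
/-- If `p` acts "surjectively" on the co-localization at `p`, then homomorphisms from `R_p` only
see the secondary components with attached prime strictly inside `p`. -/
lemma colocalization_mem_finset_sup_of_smul_top {n : ℕ} {N : Fin n → Submodule R M}
    {P : Fin n → Ideal R} (hN : ∀ i, IsSecondaryAt (P i) (N i))
    (hι : ⨆ i, N i = LinearMap.range ι) (hp : p.asIdeal.FG)
    (htop : p.asIdeal.map (algebraMap R Rp) • (⊤ : Submodule Rp (colocalization p X)) = ⊤)
    {s : Finset (Fin n)} (hs : ∀ i ∉ s, ¬ P i < p.asIdeal) (f : colocalization p X) (b : Rp) :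
    ι (colocalizationEquiv p X f b) ∈ s.sup N := by
  classical
  set t : Finset (Fin n) := {i | P i ≤ p.asIdeal} with ht
  have hmem := colocalization_mem_finset_sup (p := p) (s := t) hN hι (by simp [ht])
  obtain ⟨k, hk⟩ := exists_pow_forall_smul_eq_zero hN hp (t \ s) fun i hi ↦ by
    rw [Finset.mem_sdiff, ht, Finset.mem_filter] at hi
    by_contra h
    exact hs i hi.2 (lt_of_le_not_ge hi.1.2 h)
  have htopk (k : ℕ) : (p.asIdeal.map (algebraMap R Rp)) ^ k •
      (⊤ : Submodule Rp (colocalization p X)) = ⊤ := by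
    induction k with
    | zero => simp
    | succ k ih => rw [pow_succ, Submodule.mul_smul, htop, ih]
  -- Since `H = p ^ k • H`, it suffices that multipliers in `p ^ k` push all values into the smaller
  -- sum. Such multipliers form an ideal, so elements coming from `R` suffice.
  let K : Ideal Rp :=
    { carrier := {a | ∀ (f : colocalization p X) (b : Rp),
        ι (colocalizationEquiv p X f (b * a)) ∈ s.sup N}
      add_mem' := fun {a c} ha hc f b ↦ by
        rw [mul_add, map_add, map_add]
        exact (s.sup N).add_mem (ha f b) (hc f b)
      zero_mem' := fun f b ↦ by simp
      smul_mem' := fun c a ha f b ↦ by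
        rw [smul_eq_mul, ← mul_assoc]
        exact ha f (b * c) }
  have hK : (p.asIdeal.map (algebraMap R Rp)) ^ k ≤ K := by
    rw [← Ideal.map_pow, Ideal.map_le_iff_le_comap]
    intro r hr f b
    rw [mul_comm, ← Algebra.smul_def, map_smul, map_smul]
    have hle : t.sup N ≤ (s.sup N).comap (LinearMap.lsmul R M r) :=
      Finset.sup_le fun i hi z hz ↦ by
        by_cases his : i ∈ s
        · exact (s.sup N).smul_mem r (Finset.le_sup (f := N) his hz)
        · simp [hk r hr i (Finset.mem_sdiff.2 ⟨hi, his⟩) z hz]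
    exact hle (hmem f b)
  have hf : f ∈ (p.asIdeal.map (algebraMap R Rp)) ^ k •
      (⊤ : Submodule Rp (colocalization p X)) := by
    rw [htopk k]
    exact Submodule.mem_top
  induction hf using Submodule.smul_induction_on' generalizing b with
  | smul a ha g _ => rw [colocalizationEquiv_smul]; exact hK ha g b
  | add f _ g _ hf hg =>
    rw [map_add, LinearMap.add_apply, map_add]
    exact (s.sup N).add_mem (hf b) (hg b)

/-- Multiplication by an element outside of the relevant attached primes is surjective on the
co-localization. -/
lemma exists_algebraMap_smul_eq_colocalization (hlc : IsLinearlyCompact R M)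
    (hι : Function.Injective ι) {n : ℕ} {N : Fin n → Submodule R M} {P : Fin n → Ideal R}
    (hcl : ∀ i, IsClosed (N i : Set M)) (hN : ∀ i, IsSecondaryAt (P i) (N i))
    {s : Finset (Fin n)} (hs : s.sup N ≤ LinearMap.range ι) {r : R} (hr : ∀ i ∈ s, r ∉ P i)
    (f : colocalization p X) (hf : ∀ b, ι (colocalizationEquiv p X f b) ∈ s.sup N) :
    ∃ g : colocalization p X, algebraMap R Rp r • g = f := by
  let F : Rp →ₗ[R] M := ι ∘ₗ colocalizationEquiv p X f
  let S := p.asIdeal.primeCompl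
  -- The value of the preimage at `1/t` must be a solution of `r • z = f(1/t)`; solutions inside the
  -- closed sum form closed cosets.
  obtain ⟨g, hg, hgc⟩ := hlc.exists_compatible S
    (fun t ↦ (s.sup N : Submodule R M) ∩ {z | r • z = F (IsLocalization.mk' Rp 1 t)})
    (fun t ↦ by
      obtain ⟨z, hz, hzy⟩ := exists_smul_eq_of_mem_finset_sup hN hr (hf (IsLocalization.mk' Rp 1 t))
      exact (isClosedCoset_coe (hlc.isClosed_finset_sup s hcl)).inter
        (hlc.isClosedCoset_smul_eq hzy) ⟨z, hz, hzy⟩)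
    (by
      rintro t t' z ⟨hz, hzy⟩
      refine ⟨(s.sup N).smul_mem _ hz, ?_⟩
      rw [Set.mem_ofPred_eq] at hzy ⊢
      rw [smul_comm, hzy, ← map_smul, IsLocalization.smul_mk', mul_one]
      congr 1
      rw [IsLocalization.mk'_eq_iff_eq]
      simp [mul_comm])
  obtain ⟨G, hG⟩ := IsLocalization.exists_linearMap_of_compatible S Rp g hgc
  obtain ⟨G', hG'⟩ := exists_colocalization_lift hι G fun b ↦ by
    obtain ⟨a, t, rfl⟩ := IsLocalization.exists_mk'_eq S b
    rw [hG]
    exact hs ((s.sup N).smul_mem _ (hg t).1)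
  refine ⟨(colocalizationEquiv p X).symm G', colocalization_ext fun b ↦ hι ?_⟩
  rw [colocalizationEquiv_algebraMap_smul, AddEquiv.apply_symm_apply, map_smul, hG']
  obtain ⟨a, t, rfl⟩ := IsLocalization.exists_mk'_eq S b
  rw [hG, smul_comm, (hg t).2, ← map_smul, IsLocalization.smul_mk', mul_one]
  rfl

end CoLocalization

/-! ### The induction on the cograde -/

section DimensionBound

/-- `A/Q` is a quotient of `(A/P)/(x)`, and killing a nonzerodivisor lowers the dimension by at
least one. -/
lemma ringKrullDim_quotient_add_one_le {A : Type*} [CommRing A] {P Q : Ideal A} [P.IsPrime]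
    (h : P ≤ Q) {x : A} (hxQ : x ∈ Q) (hxP : x ∉ P) :
    ringKrullDim (A ⧸ Q) + 1 ≤ ringKrullDim (A ⧸ P) := by
  have hx : Ideal.Quotient.mk P x ∈ nonZeroDivisors (A ⧸ P) :=
    mem_nonZeroDivisors_of_ne_zero fun h ↦ hxP (Ideal.Quotient.eq_zero_iff_mem.1 h)
  refine le_trans ?_ (ringKrullDim_quotient_succ_le_of_nonZeroDivisor hx)
  gcongr
  let φ : (A ⧸ P) ⧸ Ideal.span {Ideal.Quotient.mk P x} →+* A ⧸ Q :=
    Ideal.Quotient.lift _ (Ideal.Quotient.factor h) (by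
      intro a ha
      have : Ideal.span {Ideal.Quotient.mk P x} ≤ RingHom.ker (Ideal.Quotient.factor h) := by
        rw [Ideal.span_singleton_le_iff_mem, RingHom.mem_ker, Ideal.Quotient.factor_mk]
        exact Ideal.Quotient.eq_zero_iff_mem.2 hxQ
      exact this ha)
  exact ringKrullDim_le_of_surjective φ
    (Ideal.Quotient.lift_surjective_of_surjective _ _ (Ideal.Quotient.factor_surjective h))

lemma smul_id_quotient_eq_zero {A : Type u} [CommRing A] {I : Ideal A} {x : A} (hx : x ∈ I) :
    x • 𝟙 (ModuleCat.of A (A ⧸ I)) = 0 := by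
  refine ModuleCat.hom_ext (LinearMap.ext fun z ↦ ?_)
  obtain ⟨a, rfl⟩ := Ideal.Quotient.mk_surjective z
  change Ideal.Quotient.mk I (x * a) = 0
  exact Ideal.Quotient.eq_zero_iff_mem.2 (I.mul_mem_right _ hx)

variable {R : Type u} [CommRing R] {p : PrimeSpectrum R} {X : Type u} [AddCommGroup X] [Module R X]

local notation "Rp" => Localization.AtPrime (PrimeSpectrum.asIdeal p)

/-- The inclusion `Hom(R_p, (0 :_X r)) ⟶ Hom(R_p, X)`. -/
noncomputable def colocalizationTorsionInclusion (p : PrimeSpectrum R) (X : Type u)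
    [AddCommGroup X] [Module R X] (r : R) :
    colocalization p (Submodule.torsionBy R X r) ⟶ colocalization p X :=
  (ModuleCat.coextendScalars (algebraMap R (Localization.AtPrime p.asIdeal))).map
    (ModuleCat.ofHom (Submodule.torsionBy R X r).subtype)

lemma colocalizationTorsionInclusion_apply (r : R)
    (f : colocalization p (Submodule.torsionBy R X r)) (b : Rp) :
    colocalizationEquiv p X ((colocalizationTorsionInclusion p X r).hom f) b =
      colocalizationEquiv p _ f b := rfl

lemma colocalization_torsionBy_smul (r : R) (f : colocalization p (Submodule.torsionBy R X r)) :
    algebraMap R Rp r • f = 0 := by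
  refine colocalization_ext fun b ↦ ?_
  rw [colocalizationEquiv_algebraMap_smul, map_zero, LinearMap.zero_apply]
  exact Subtype.ext ((Submodule.mem_torsionBy_iff _ _).1 (colocalizationEquiv p _ f b).2)

lemma colocalization_shortExact (r : R)
    (hr : ∀ f : colocalization p X, ∃ g : colocalization p X, algebraMap R Rp r • g = f) :
    ∃ w, (ShortComplex.mk (colocalizationTorsionInclusion p X r)
      (algebraMap R Rp r • 𝟙 (colocalization p X)) w).ShortExact := by
  refine ⟨?_, ShortComplex.ShortExact.mk' ?_ ?_ ?_⟩
  · ext f : 2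
    change algebraMap R Rp r • (colocalizationTorsionInclusion p X r).hom f = 0
    rw [← map_smul, colocalization_torsionBy_smul, map_zero]
  · rw [ShortComplex.moduleCat_exact_iff]
    intro f hf
    replace hf : algebraMap R Rp r • f = 0 := hf
    have hmem (b : Rp) : colocalizationEquiv p X f b ∈
        LinearMap.range (Submodule.torsionBy R X r).subtype := by
      rw [Submodule.range_subtype, Submodule.mem_torsionBy_iff,
        ← colocalizationEquiv_algebraMap_smul, hf]
      simp
    obtain ⟨g, hg⟩ := exists_colocalization_lift (Submodule.injective_subtype _) _ hmem
    exact ⟨(colocalizationEquiv p _).symm g, colocalization_ext hg⟩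
  · rw [ModuleCat.mono_iff_injective]
    exact fun f g hfg ↦ colocalization_ext fun b ↦ Subtype.ext
      (DFunLike.congr_fun (congrArg (colocalizationEquiv p X) hfg) b)
  · rw [ModuleCat.epi_iff_surjective]
    exact hr

variable {M : Type v} [AddCommGroup M] [Module R M] [TopologicalSpace M]

lemma IsLinearlyCompact.isClosed_torsionBySet (hlc : IsLinearlyCompact R M) (J : Set R) :
    IsClosed (Submodule.torsionBySet R M J : Set M) := by
  have : (Submodule.torsionBySet R M J : Set M) =
      ⋂ a ∈ J, ((⊥ : Submodule R M).comap (LinearMap.lsmul R M a) : Set M) := by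
    ext x
    simp
  rw [this]
  exact isClosed_biInter fun a _ ↦ hlc.isClosed_comap_smul hlc.isClosed_bot a

/-- Carrying `X` as the image `(0 :_M J)` of an embedding into the fixed module `M` lets the
induction pass to `(0 :_X r) = (0 :_M J + (r))` while all topology stays on `M`. -/
lemma exists_mem_cosupport_of_tor [IsNoetherianRing R] (hlc : IsLinearlyCompact R M)
    (hsr : IsStronglyRepresentable R M) (n : ℕ) (J : Ideal R) (ι : X →ₗ[R] M)
    (hι : Function.Injective ι) (hJ : LinearMap.range ι = Submodule.torsionBySet R M (J : Set R))
    (hlt : ∀ i < n, ¬ Nontrivial (((Tor' (ModuleCat.{u} Rp) i).obj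
      (ModuleCat.of Rp (Rp ⧸ p.asIdeal.map (algebraMap R Rp)))).obj (colocalization p X)))
    (hn : Nontrivial (((Tor' (ModuleCat.{u} Rp) n).obj
      (ModuleCat.of Rp (Rp ⧸ p.asIdeal.map (algebraMap R Rp)))).obj (colocalization p X))) :
    ∃ q ∈ cosupport Rp (colocalization p X),
      ((n : ℕ∞) : WithBot ℕ∞) ≤ ringKrullDim (Rp ⧸ q.asIdeal) := by
  classical
  have hdec (J : Ideal R) := (hsr.isRepresentable_torsionBySet J
    (IsNoetherian.noetherian J)).exists_closed hlc (hlc.isClosed_torsionBySet J)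
  induction n generalizing X J with
  | zero =>
    obtain ⟨m, N, P, hP, hcl, hN, hsup⟩ := hdec J
    rw [← hJ] at hsup
    have hle (i : Fin m) : N i ≤ LinearMap.range ι := hsup ▸ le_iSup N i
    rw [nontrivial_tor'_zero] at hn
    have : Nontrivial (colocalization p X) := by
      by_contra h
      rw [not_nontrivial_iff_subsingleton] at h
      exact hn (Subsingleton.elim _ _)
    obtain ⟨f, hf⟩ := exists_ne (0 : colocalization p X)
    have hex : ∃ i, P i ≤ p.asIdeal := by
      by_contra! hno
      refine hf (colocalization_ext fun b ↦ hι ?_)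
      have := colocalization_mem_finset_sup (s := ∅) hN hsup (fun i _ ↦ hno i) f b
      simpa using this
    obtain ⟨i, hi⟩ := hex
    obtain ⟨q, -, -, hq⟩ := map_mem_cosupport_colocalization hlc hι (hcl i) (hle i) (hP i) (hN i) hi
    exact ⟨q, hq, by simpa using ringKrullDim_nonneg_of_nontrivial⟩
  | succ n ih =>
    obtain ⟨m, N, P, hP, hcl, hN, hsup⟩ := hdec J
    rw [← hJ] at hsup
    have hle (i : Fin m) : N i ≤ LinearMap.range ι := hsup ▸ le_iSup N i
    have htop := not_not.1 (mt nontrivial_tor'_zero.2 (hlt 0 n.succ_pos))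
    set s : Finset (Fin m) := {i | P i < p.asIdeal} with hs
    have hmem := colocalization_mem_finset_sup_of_smul_top (s := s) hN hsup
      (IsNoetherian.noetherian _) htop (by simp [hs])
    obtain ⟨r, hrp, hr⟩ : ∃ r ∈ p.asIdeal, ∀ i ∈ s, r ∉ P i := by
      by_contra! hno
      have hsub : (p.asIdeal : Set R) ⊆ ⋃ i ∈ (s : Set (Fin m)), P i := fun r hr ↦ by
        simpa using hno r hr
      -- Prime avoidance asks for exceptional indices; all `P i` being prime, any index will do.
      obtain ⟨i₀, -⟩ := hno 0 p.asIdeal.zero_mem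
      obtain ⟨i, hi, hpi⟩ := (Ideal.subset_union_prime (s := s) i₀ i₀
        (fun i _ _ _ ↦ hP i)).1 hsub
      exact (Finset.mem_filter.1 hi).2.not_ge hpi
    obtain ⟨w, hS⟩ := colocalization_shortExact r fun f ↦
      exists_algebraMap_smul_eq_colocalization hlc hι hcl hN (Finset.sup_le fun i _ ↦ hle i) hr f
        (hmem f)
    have hx : algebraMap R Rp r • 𝟙 (ModuleCat.of Rp (Rp ⧸ p.asIdeal.map (algebraMap R Rp))) = 0 :=
      smul_id_quotient_eq_zero (Ideal.mem_map_of_mem _ hrp)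
    have hJ' : LinearMap.range (ι ∘ₗ (Submodule.torsionBy R X r).subtype) =
        Submodule.torsionBySet R M ((J ⊔ Ideal.span {r} : Ideal R) : Set R) := by
      rw [LinearMap.range_comp, Submodule.range_subtype]
      refine le_antisymm ?_ fun y hy ↦ ?_
      · rintro _ ⟨x, hx, rfl⟩
        have hxJ : ι x ∈ Submodule.torsionBySet R M (J : Set R) := hJ ▸ LinearMap.mem_range_self ι x
        rw [Submodule.mem_torsionBySet_iff] at hxJ ⊢
        rintro ⟨a, ha⟩
        obtain ⟨b, hb, c, hc, rfl⟩ := Submodule.mem_sup.1 ha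
        obtain ⟨d, rfl⟩ := Ideal.mem_span_singleton'.1 hc
        have hrx : r • x = 0 := hx
        simpa [add_smul, mul_smul, ← map_smul ι r, hrx] using hxJ ⟨b, hb⟩
      · rw [Submodule.mem_torsionBySet_iff] at hy
        obtain ⟨x, rfl⟩ : y ∈ LinearMap.range ι := by
          rw [hJ, Submodule.mem_torsionBySet_iff]
          exact fun a ↦ hy ⟨a, Ideal.mem_sup_left a.2⟩
        refine ⟨x, hι ?_, rfl⟩
        rw [map_zero, DistribSMul.toLinearMap_apply, map_smul]
        exact hy ⟨r, Ideal.mem_sup_right (Ideal.mem_span_singleton_self r)⟩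
    obtain ⟨q, hq, hnq⟩ := ih (X := Submodule.torsionBy R X r) (J ⊔ Ideal.span {r})
      (ι ∘ₗ (Submodule.torsionBy R X r).subtype) (hι.comp (Submodule.injective_subtype _)) hJ'
      (fun i hi ↦ (tor'_kernel_smul _ hx _ w hS i).1 (hlt _ (by lia)) (hlt _ (by lia)))
      ((tor'_kernel_smul _ hx _ w hS n).2 hn)
    have hrq : algebraMap R Rp r ∈ q.asIdeal := by
      by_contra hrq
      exact not_mem_cosupport hrq (colocalization_torsionBy_smul r) hq
    -- Otherwise some `a` outside `q` kills all components in `s`, hence kills the kernel, whose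
    -- maps take values in their sum.
    obtain ⟨i, his, hi⟩ : ∃ i ∈ s, P i ≤ q.asIdeal.comap (algebraMap R Rp) := by
      by_contra! hno
      obtain ⟨a, ha, haN⟩ := exists_notMem_forall_smul_eq_zero hN
        (q.isPrime.comap (algebraMap R Rp)) s hno
      refine not_mem_cosupport ha (fun f ↦ colocalization_ext fun b ↦ Subtype.ext (hι ?_)) hq
      have hb := hmem ((colocalizationTorsionInclusion p X r).hom f) b
      rw [colocalizationTorsionInclusion_apply] at hb
      have hker : s.sup N ≤ LinearMap.ker (LinearMap.lsmul R M a) :=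
        Finset.sup_le fun i hi y hy ↦ by simpa using haN i hi y hy
      have := hker hb
      rw [LinearMap.mem_ker, LinearMap.lsmul_apply, ← map_smul] at this
      rw [colocalizationEquiv_algebraMap_smul]
      simpa using this
    obtain ⟨q', hq'P, hq'c, hq'⟩ := map_mem_cosupport_colocalization hlc hι (hcl i) (hle i) (hP i)
      (hN i) (Finset.mem_filter.1 his).2.le
    refine ⟨q', hq', ?_⟩
    have hdim := ringKrullDim_quotient_add_one_le (P := q'.asIdeal) (Q := q.asIdeal)
      (hq'P ▸ Ideal.map_le_iff_le_comap.2 hi) hrq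
      (fun h ↦ hr i his (hq'c ▸ Ideal.mem_comap.2 h))
    refine le_trans ?_ hdim
    push_cast
    gcongr
    exact hnq

end DimensionBound

theorem proposition5p9 (R : Type u) [CommRing R] [IsNoetherianRing R]
    (M : Type u) [AddCommGroup M] [Module R M] [TopologicalSpace M]
    (hlc : IsLinearlyCompact R M) (hsr : IsStronglyRepresentable R M)
    (p : PrimeSpectrum R) (hp : p ∈ cosupport R M)
    (hfin : colocalizationCograde p M < ⊤) :
    (colocalizationCograde p M : WithBot ℕ∞) ≤
      coDim (Localization.AtPrime p.asIdeal) (colocalization p M) := by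
  classical
  let T (n : ℕ) : Prop := Nontrivial (((Tor' (ModuleCat.{u} (Localization.AtPrime p.asIdeal)) n).obj
    (ModuleCat.of _ (Localization.AtPrime p.asIdeal ⧸
      p.asIdeal.map (algebraMap R (Localization.AtPrime p.asIdeal))))).obj (colocalization p M))
  have hcg : colocalizationCograde p M = ⨅ (i : ℕ) (_ : T i), (i : ℕ∞) := rfl
  -- An infimum over no degrees is `⊤`, so finiteness provides a non-zero `Tor`.
  have hex : ∃ n, T n := by
    by_contra! hno
    simp [hcg, hno] at hfin
  obtain ⟨q, hq, hnq⟩ := exists_mem_cosupport_of_tor hlc hsr (Nat.find hex) ⊥ LinearMap.id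
    Function.injective_id (by ext; simp) (fun i hi ↦ Nat.find_min hex hi) (Nat.find_spec hex)
  calc (colocalizationCograde p M : WithBot ℕ∞) ≤ ((Nat.find hex : ℕ∞) : WithBot ℕ∞) := by
        rw [hcg]
        exact WithBot.coe_le_coe.2 (iInf₂_le _ (Nat.find_spec hex))
    _ ≤ _ := hnq
    _ ≤ _ := le_iSup₂_of_le q hq le_rfl
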